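/- Let $\mathbb D=\{z\in\mathbb C:|z|<1\}$. Consider complex-valued harmonic functions $f$ on $\mathbb D$ that are sense-preserving (the Jacobian of $f$ is positive at every point of $\mathbb D$) and normalized by $f(0)=0$, $f_z(0)=1$. Each such $f$ is written canonically as $f=h+\overline g$ with $h,g$ analytic in $\mathbb D$ and $g(0)=0$; write $h(z)=z+\sum_{k\ge2}a_kz^k$ and $g(z)=\sum_{k\ge1}b_kz^k$. A family $\mathscr F$ of such functions is called affine and linear invariant if for every $f=h+\overline g\in\mathscr F$, all $\theta\in\mathbb R$, $a\in\mathbb D$ and $\epsilon\in\mathbb D$, the functions $$z\mapsto\frac{f\left(e^{i\theta}\frac{z+a}{1+\overline az}\right)-f(ae^{i\theta})}{(1-|a|^2)\,h'(ae^{i\theta})\,e^{i\theta}}\qquad\text{and}\qquad z\mapsto\frac{f(z)+\epsilon\,\overline{f(z)}}{1+\epsilon\,\overline{f_{\overline z}(0)}}$$ also belong to $\mathscr F$. Its order is $$\overline{\mathrm{ord}}\,\mathscr F=\sup_{f\in\mathscr F}\frac{|a_2-\overline{b_1}\,b_2|}{1-|b_1|^2}.$$ For $\alpha\geq 0$ let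 $\mathscr U_H(\alpha)$ be the union of all affine and linear invariant families $\mathscr F$ with $\overline{\mathrm{ord}}\,\mathscr F\le\alpha$, and let $\mathscr U_H^0(\alpha)=\{f\in\mathscr U_H(\alpha):f_{\overline z}(0)=0\}$. Let $\mathcal S_H^0$ be the class of all univalent (injective) sense-preserving harmonic functions $f$ on $\mathbb D$ with $f(0)=0$, $f_z(0)=1$ and $f_{\overline z}(0)=0$. Suppose that $f=h+\overline g\in\mathscr U_H^0(5/2)\cap\mathcal S_H^0$, and for $n\ge1$ let $$s_{n,n}(f)(z)=\sum_{k=1}^n a_kz^k+\overline{\sum_{k=1}^n b_kz^k},\qquad a_1=1 .$$ Then $s_{n,n}(f)$ is univalent in the disk $|z|<r$, where (i) $r=1/4$ whenever $n\ge10$; (ii) $r=1/2$ whenever $n\ge29$; and (iii) $r=3/4$ whenever $n\ge98$. -/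

import Mathlib

open scoped ENNReal ComplexConjugate

namespace HarmonicMapping

/-- The open unit disk `|z| < 1`. -/
abbrev disk : Set ℂ := Metric.ball (0 : ℂ) 1

/-- The Wirtinger derivative `f_z = (f_x - i f_y) / 2`. -/
noncomputable def dz (f : ℂ → ℂ) (z : ℂ) : ℂ :=
  (fderiv ℝ f z 1 - Complex.I * fderiv ℝ f z Complex.I) / 2

/-- The Wirtinger derivative `f_z̄ = (f_x + i f_y) / 2`. -/
noncomputable def dzbar (f : ℂ → ℂ) (z : ℂ) : ℂ :=
  (fderiv ℝ f z 1 + Complex.I * fderiv ℝ f z Complex.I) / 2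

/-- Complex-valued harmonic functions of the unit disk that are sense-preserving, i.e. have
positive Jacobian determinant at every point of the disk, and are normalized by
`f(0) = 0` and `f_z(0) = 1`. Values outside the disk are irrelevant. -/
structure IsNormalizedMapping (f : ℂ → ℂ) : Prop where
  harmonic : InnerProductSpace.HarmonicOnNhd f disk
  sensePreserving : ∀ z ∈ disk, 0 < (fderiv ℝ f z).det
  map_zero : f 0 = 0
  dz_zero : dz f 0 = 1

/-- The class `S_H`: univalent, sense-preserving, normalized harmonic functions of the disk. -/
def classSH : Set (ℂ → ℂ) := {f | IsNormalizedMapping f ∧ Set.InjOn f disk}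

/-- The class `S_H^0`: those `f ∈ S_H` with `f_z̄(0) = 0` (equivalently, `g'(0) = 0`). -/
def classSH0 : Set (ℂ → ℂ) := {f ∈ classSH | dzbar f 0 = 0}

/-- The canonical representation `f = h + conj g` on the disk, with `h`, `g` analytic there
and `g(0) = 0`. -/
structure IsCanonicalRep (f h g : ℂ → ℂ) : Prop where
  analytic_left : AnalyticOnNhd ℂ h disk
  analytic_right : AnalyticOnNhd ℂ g disk
  right_zero : g 0 = 0
  eq_add_conj : ∀ z ∈ disk, f z = h z + conj (g z)

/-- The `k`-th Taylor coefficient at the origin. -/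
noncomputable def coeff (h : ℂ → ℂ) (k : ℕ) : ℂ := iteratedDeriv k h 0 / (k.factorial : ℂ)

/-- The section `s_n(h)(z) = ∑_{k=1}^n a_k z^k`. -/
noncomputable def partialSum (n : ℕ) (h : ℂ → ℂ) (z : ℂ) : ℂ :=
  ∑ k ∈ Finset.Icc 1 n, coeff h k * z ^ k

/-- The section `s_{n,m}(f) = s_n(h) + conj (s_m(g))` of `f = h + conj g`. -/
noncomputable def harmonicSection (n m : ℕ) (h g : ℂ → ℂ) (z : ℂ) : ℂ :=
  partialSum n h z + conj (partialSum m g z)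

/-- The Koebe transform
`F(z) = (f(e^{iθ} (z + a) / (1 + ā z)) - f(a e^{iθ})) / ((1 - |a|²) f_z(a e^{iθ}) e^{iθ})`;
here `f_z = h'` for `f = h + conj g`. -/
noncomputable def koebeTransform (f : ℂ → ℂ) (θ : ℝ) (a z : ℂ) : ℂ :=
  (f (Complex.exp (θ * Complex.I) * ((z + a) / (1 + conj a * z)))
      - f (a * Complex.exp (θ * Complex.I))) /
    ((1 - (‖a‖ : ℂ) ^ 2) * dz f (a * Complex.exp (θ * Complex.I)) * Complex.exp (θ * Complex.I))

/-- The affine transform `(f + ε f̄) / (1 + ε conj (f_z̄(0)))`. -/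
noncomputable def affineTransform (f : ℂ → ℂ) (ε z : ℂ) : ℂ :=
  (f z + ε * conj (f z)) / (1 + ε * conj (dzbar f 0))

/-- Affine and linear invariant families of normalized sense-preserving harmonic functions of the
disk. Functions are identified when they agree on the disk, so a transform of `f` belongs to the
family when some member of the family agrees with it on the disk. -/
structure IsAffineLinearInvariant (𝓕 : Set (ℂ → ℂ)) : Prop where
  normalized : ∀ f ∈ 𝓕, IsNormalizedMapping f
  linear : ∀ f ∈ 𝓕, ∀ θ : ℝ, ∀ a ∈ disk, ∃ F ∈ 𝓕, Set.EqOn F (koebeTransform f θ a) disk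
  affine : ∀ f ∈ 𝓕, ∀ ε ∈ disk, ∃ F ∈ 𝓕, Set.EqOn F (affineTransform f ε) disk

/-- The order `sup_{f ∈ 𝓕} |a₂ - conj b₁ b₂| / (1 - |b₁|²)`, where `f = h + conj g`,
`h = ∑ a_k z^k` and `g = ∑ b_k z^k`. The supremum is taken in `[0, ∞]`. -/
noncomputable def upperOrder (𝓕 : Set (ℂ → ℂ)) : ℝ≥0∞ :=
  ⨆ (f ∈ 𝓕) (h : ℂ → ℂ) (g : ℂ → ℂ) (_ : IsCanonicalRep f h g),
    ENNReal.ofReal (‖coeff h 2 - conj (coeff g 1) * coeff g 2‖ / (1 - ‖coeff g 1‖ ^ 2))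

/-- The family `U_H(α)`: the union of all affine and linear invariant families whose order
`upperOrder` is at most `α`. -/
def classUH (α : ℝ≥0∞) : Set (ℂ → ℂ) :=
  ⋃₀ {𝓕 | IsAffineLinearInvariant 𝓕 ∧ upperOrder 𝓕 ≤ α}

/-- The family `U_H^0(α)`: those `f ∈ U_H(α)` with `f_z̄(0) = 0`. -/
def classUH0 (α : ℝ≥0∞) : Set (ℂ → ℂ) := {f ∈ classUH α | dzbar f 0 = 0}

end HarmonicMapping

namespace HarmonicMapping

open Set Metric Filter Topology

/-! On `|z| < r` the map `f` separates points by at least a constant `c(r)`, while the Taylor tail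
`f - s_{n,n}(f)` is Lipschitz there with a constant that decays geometrically in `n`. Once the tail
constant drops below `c(r)`, two points with the same image under the section must coincide.

Both constants come from the order bound. Applied to the Koebe transform of `f` at `a`, it controls
the logarithmic derivative of the Jacobian `J = |h'|² - |g'|²`; integration along rays gives
`(1-t)³/(1+t)⁷ ≤ J/J(0) ≤ (1+t)³/(1-t)⁷` (`jac_lower`, `jac_upper`). The Schwarz–Pick bound on the
dilatation `g'/h'` splits this into a lower bound for `|h'| - |g'|` and upper bounds for `|h'|` and
`|g'|`.

Lower constant: since `f` is injective, the preimage of a shortest segment from `0` to the image of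
a circle can be measured against the lower bound for `|h'| - |g'|` (`le_norm_of_injOn`). The
resulting growth estimate, applied to Koebe transforms, becomes the two-point estimate
`norm_sub_ge`.

Tail constant: the upper bounds on a circle `|z| = R` with `r < R < 1`, together with Cauchy's
estimates for `h'` and `g'`, give `norm_tail_sub_le`. A numerical choice of `R` finishes each case.
-/

/-! ### Derivatives of `h + conj g` -/

/-- The real-linear map `v ↦ p v + conj (q v)`. -/
noncomputable def wirtingerMap (p q : ℂ) : ℂ →L[ℝ] ℂ :=
  (ContinuousLinearMap.toSpanSingleton ℂ p).restrictScalars ℝ +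
    (Complex.conjCLE : ℂ →L[ℝ] ℂ).comp
      ((ContinuousLinearMap.toSpanSingleton ℂ q).restrictScalars ℝ)

theorem wirtingerMap_apply (p q v : ℂ) : wirtingerMap p q v = p * v + conj (q * v) := by
  simp [wirtingerMap, mul_comm]

theorem det_wirtingerMap (p q : ℂ) : (wirtingerMap p q).det = ‖p‖ ^ 2 - ‖q‖ ^ 2 := by
  rw [ContinuousLinearMap.det, ← LinearMap.det_toMatrix Complex.basisOneI, Matrix.det_fin_two]
  simp only [LinearMap.toMatrix_apply, Complex.coe_basisOneI, Complex.coe_basisOneI_repr,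
    ContinuousLinearMap.coe_coe, wirtingerMap_apply, ← Complex.normSq_eq_norm_sq]
  simp [Complex.normSq_apply]
  ring

theorem norm_wirtingerMap_ge (p q v : ℂ) : (‖p‖ - ‖q‖) * ‖v‖ ≤ ‖wirtingerMap p q v‖ := by
  rw [wirtingerMap_apply]
  have := norm_sub_norm_le (p * v) (-conj (q * v))
  simp only [sub_neg_eq_add, norm_neg, RCLike.norm_conj, norm_mul] at this
  linarith

theorem mem_disk {z : ℂ} : z ∈ disk ↔ ‖z‖ < 1 := mem_ball_zero_iff

theorem zero_mem_disk : (0 : ℂ) ∈ disk := mem_disk.2 (by simp)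

theorem disk_mem_nhds {z : ℂ} (hz : z ∈ disk) : disk ∈ 𝓝 z := isOpen_ball.mem_nhds hz

variable {f h g : ℂ → ℂ}

theorem IsCanonicalRep.hasStrictFDerivAt (hr : IsCanonicalRep f h g) {z : ℂ} (hz : z ∈ disk) :
    HasStrictFDerivAt f (wirtingerMap (deriv h z) (deriv g z)) z := by
  have h1 := (hr.analytic_left z hz).hasStrictDerivAt.hasStrictFDerivAt.restrictScalars ℝ
  have h2 := (hr.analytic_right z hz).hasStrictDerivAt.hasStrictFDerivAt.restrictScalars ℝ
  have h3 := h1.add ((Complex.conjCLE : ℂ →L[ℝ] ℂ).hasStrictFDerivAt.comp z h2)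
  refine h3.congr_of_eventuallyEq ?_
  filter_upwards [disk_mem_nhds hz] with w hw
  simp [hr.eq_add_conj w hw]

theorem IsCanonicalRep.fderiv_eq (hr : IsCanonicalRep f h g) {z : ℂ} (hz : z ∈ disk) :
    fderiv ℝ f z = wirtingerMap (deriv h z) (deriv g z) :=
  (hr.hasStrictFDerivAt hz).hasFDerivAt.fderiv

theorem IsCanonicalRep.dz_eq (hr : IsCanonicalRep f h g) {z : ℂ} (hz : z ∈ disk) :
    dz f z = deriv h z := by
  rw [dz, hr.fderiv_eq hz, wirtingerMap_apply, wirtingerMap_apply]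
  simp only [map_mul, Complex.conj_I, map_one]
  linear_combination (-(deriv h z) / 2 + conj (deriv g z) / 2) * Complex.I_sq

theorem IsCanonicalRep.dzbar_eq (hr : IsCanonicalRep f h g) {z : ℂ} (hz : z ∈ disk) :
    dzbar f z = conj (deriv g z) := by
  rw [dzbar, hr.fderiv_eq hz, wirtingerMap_apply, wirtingerMap_apply]
  simp only [map_mul, Complex.conj_I, map_one]
  linear_combination ((deriv h z) / 2 - conj (deriv g z) / 2) * Complex.I_sq

theorem IsCanonicalRep.norm_deriv_lt (hr : IsCanonicalRep f h g) (hf : IsNormalizedMapping f)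
    {z : ℂ} (hz : z ∈ disk) : ‖deriv g z‖ < ‖deriv h z‖ := by
  have := hf.sensePreserving z hz
  rw [hr.fderiv_eq hz, det_wirtingerMap] at this
  exact lt_of_pow_lt_pow_left₀ 2 (norm_nonneg _) (by linarith)

theorem IsCanonicalRep.deriv_ne_zero (hr : IsCanonicalRep f h g) (hf : IsNormalizedMapping f)
    {z : ℂ} (hz : z ∈ disk) : deriv h z ≠ 0 :=
  norm_pos_iff.1 ((norm_nonneg _).trans_lt (hr.norm_deriv_lt hf hz))

/-! ### Disk automorphisms -/

/-- The disk automorphism `z ↦ (z + a) / (1 + ā z)`. -/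
noncomputable def mobius (a z : ℂ) : ℂ := (z + a) / (1 + conj a * z)

theorem one_add_conj_mul_ne_zero {a z : ℂ} (ha : a ∈ disk) (hz : z ∈ disk) :
    1 + conj a * z ≠ 0 := by
  rw [mem_disk] at ha hz
  intro h0
  have : ‖conj a * z‖ = 1 := by
    rw [show conj a * z = -1 by linear_combination h0]; simp
  rw [norm_mul, RCLike.norm_conj] at this
  nlinarith [norm_nonneg a, norm_nonneg z]

theorem one_sub_norm_sq_ne_zero {a : ℂ} (ha : a ∈ disk) : (1 - (‖a‖ : ℂ) ^ 2) ≠ 0 := by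
  rw [mem_disk] at ha
  have : (1 - ‖a‖ ^ 2 : ℝ) ≠ 0 := by nlinarith [norm_nonneg a]
  exact_mod_cast this

theorem norm_one_add_conj_mul_sq_sub (a z : ℂ) :
    ‖1 + conj a * z‖ ^ 2 - ‖z + a‖ ^ 2 = (1 - ‖a‖ ^ 2) * (1 - ‖z‖ ^ 2) := by
  simp only [← Complex.normSq_eq_norm_sq, Complex.normSq_apply]
  simp
  ring

theorem mobius_mem_disk {a z : ℂ} (ha : a ∈ disk) (hz : z ∈ disk) : mobius a z ∈ disk := by
  have h0 := norm_pos_iff.2 (one_add_conj_mul_ne_zero ha hz)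
  rw [mem_disk, mobius, norm_div, div_lt_one h0]
  refine lt_of_pow_lt_pow_left₀ 2 (norm_nonneg _) ?_
  rw [mem_disk] at ha hz
  have key := norm_one_add_conj_mul_sq_sub a z
  have : 0 < (1 - ‖a‖ ^ 2) * (1 - ‖z‖ ^ 2) := by
    apply mul_pos <;> nlinarith [norm_nonneg a, norm_nonneg z]
  linarith

theorem hasDerivAt_mobius {a z : ℂ} (ha : a ∈ disk) (hz : z ∈ disk) :
    HasDerivAt (mobius a) ((1 - (‖a‖ : ℂ) ^ 2) / (1 + conj a * z) ^ 2) z := by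
  have h1 := ((hasDerivAt_id z).add_const a).div
    (((hasDerivAt_id z).const_mul (conj a)).const_add 1) (one_add_conj_mul_ne_zero ha hz)
  refine HasDerivAt.congr_deriv (f := mobius a) h1 ?_
  congr 1
  simp only [id]
  linear_combination -Complex.conj_mul' a

theorem mobius_zero (a : ℂ) : mobius a 0 = a := by simp [mobius]

theorem mobius_neg_mobius {a z : ℂ} (ha : a ∈ disk) (hz : z ∈ disk) :
    mobius a (mobius (-a) z) = z := by
  have h1 : 1 - conj a * z ≠ 0 := by
    have := one_add_conj_mul_ne_zero (a := -a) (by simpa [mem_disk] using ha) hz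
    simpa [sub_eq_add_neg] using this
  have h2 : 1 - conj a * a ≠ 0 := by
    rw [Complex.conj_mul']; exact one_sub_norm_sq_ne_zero ha
  have e : mobius (-a) z = (z - a) / (1 - conj a * z) := by simp [mobius, sub_eq_add_neg]
  have h3 : 1 + conj a * ((z - a) / (1 - conj a * z)) = (1 - conj a * a) / (1 - conj a * z) := by
    field_simp; ring
  rw [e, mobius, h3, div_add' _ _ _ h1, div_div_div_cancel_right₀ h1, div_eq_iff h2]
  ring

theorem injOn_mobius {a : ℂ} (ha : a ∈ disk) : InjOn (mobius a) disk := by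
  intro z hz w hw e
  have ha' : -a ∈ disk := by simpa [mem_disk] using ha
  have := mobius_neg_mobius ha' hz
  rw [neg_neg, e] at this
  have h2 := mobius_neg_mobius ha' hw
  rw [neg_neg] at h2
  rw [← this, h2]

/-! ### Koebe transforms of analytic functions -/

/-- The function `z ↦ (p(φ(z)) - p(a)) / c`, where `φ = mobius a`. -/
noncomputable def transport (p : ℂ → ℂ) (a c z : ℂ) : ℂ := (p (mobius a z) - p a) / c

theorem hasDerivAt_transport {p : ℂ → ℂ} (hp : AnalyticOnNhd ℂ p disk) {a z : ℂ} (c : ℂ)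
    (ha : a ∈ disk) (hz : z ∈ disk) :
    HasDerivAt (transport p a c)
      (deriv p (mobius a z) * ((1 - (‖a‖ : ℂ) ^ 2) / (1 + conj a * z) ^ 2) / c) z :=
  (((hp _ (mobius_mem_disk ha hz)).differentiableAt.hasDerivAt.comp z
    (hasDerivAt_mobius ha hz)).sub_const _).div_const c

theorem analyticOnNhd_transport {p : ℂ → ℂ} (hp : AnalyticOnNhd ℂ p disk) {a : ℂ} (c : ℂ)
    (ha : a ∈ disk) : AnalyticOnNhd ℂ (transport p a c) disk :=
  DifferentiableOn.analyticOnNhd (fun _ hz =>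
    (hasDerivAt_transport hp c ha hz).differentiableAt.differentiableWithinAt) isOpen_ball

theorem deriv_transport_zero {p : ℂ → ℂ} (hp : AnalyticOnNhd ℂ p disk) {a : ℂ} (c : ℂ)
    (ha : a ∈ disk) : deriv (transport p a c) 0 = (1 - (‖a‖ : ℂ) ^ 2) * deriv p a / c := by
  rw [(hasDerivAt_transport hp c ha zero_mem_disk).deriv, mobius_zero]
  simp [mul_comm]

theorem deriv_deriv_transport_zero {p : ℂ → ℂ} (hp : AnalyticOnNhd ℂ p disk) {a : ℂ} (c : ℂ)
    (ha : a ∈ disk) : deriv (deriv (transport p a c)) 0 =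
      (1 - (‖a‖ : ℂ) ^ 2) * ((1 - (‖a‖ : ℂ) ^ 2) * deriv (deriv p) a
        - 2 * conj a * deriv p a) / c := by
  have e : deriv (transport p a c) =ᶠ[𝓝 0] fun z =>
      deriv p (mobius a z) * ((1 - (‖a‖ : ℂ) ^ 2) / (1 + conj a * z) ^ 2) / c := by
    filter_upwards [disk_mem_nhds zero_mem_disk] with z hz
    exact (hasDerivAt_transport hp c ha hz).deriv
  rw [e.deriv_eq]
  have hm := hasDerivAt_mobius ha zero_mem_disk
  have h1 : HasDerivAt (deriv p) (deriv (deriv p) a) (mobius a 0) := by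
    rw [mobius_zero]
    exact (hp.deriv a ha).differentiableAt.hasDerivAt
  have h2 : HasDerivAt (fun z : ℂ => (1 + conj a * z) ^ 2) (2 * conj a) 0 := by
    have := (((hasDerivAt_id' (0 : ℂ)).const_mul (conj a)).const_add 1).fun_pow 2
    simpa using this
  have h3 := ((hasDerivAt_const (0 : ℂ) (1 - (‖a‖ : ℂ) ^ 2)).div h2 (by simp))
  have h4 := ((h1.comp 0 hm).mul h3).div_const c
  refine h4.deriv.trans ?_
  simp [mobius_zero]
  ring

theorem coeff_one (p : ℂ → ℂ) : coeff p 1 = deriv p 0 := by simp [coeff]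

theorem coeff_two (p : ℂ → ℂ) : coeff p 2 = deriv (deriv p) 0 / 2 := by
  simp [coeff, iteratedDeriv_succ]

/-! ### The second coefficient and Koebe transforms in an invariant family -/

variable {𝓕 : Set (ℂ → ℂ)}

theorem norm_coeff_le_of_upperOrder_le (ho : upperOrder 𝓕 ≤ 5 / 2) (hf : f ∈ 𝓕)
    (hr : IsCanonicalRep f h g) :
    ‖coeff h 2 - conj (coeff g 1) * coeff g 2‖ / (1 - ‖coeff g 1‖ ^ 2) ≤ 5 / 2 := by
  have h1 : ENNReal.ofReal (‖coeff h 2 - conj (coeff g 1) * coeff g 2‖ / (1 - ‖coeff g 1‖ ^ 2)) ≤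
      upperOrder 𝓕 :=
    (le_iSup_of_le f <| le_iSup_of_le hf <| le_iSup_of_le h <| le_iSup_of_le g <|
      le_iSup_of_le hr le_rfl)
  have h2 : (5 / 2 : ℝ≥0∞) = ENNReal.ofReal (5 / 2) := by
    rw [ENNReal.ofReal_div_of_pos (by norm_num)]; norm_num
  rw [h2] at ho
  exact (ENNReal.ofReal_le_ofReal_iff (by norm_num)).1 (h1.trans ho)

/-- The Koebe transform of a member of the family, together with its canonical representation. -/
theorem exists_koebe (hF : IsAffineLinearInvariant 𝓕) (hf : f ∈ 𝓕)
    (hr : IsCanonicalRep f h g) {a : ℂ} (ha : a ∈ disk) :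
    ∃ F ∈ 𝓕, IsCanonicalRep F (transport h a ((1 - (‖a‖ : ℂ) ^ 2) * deriv h a))
        (transport g a ((1 - (‖a‖ : ℂ) ^ 2) * conj (deriv h a))) ∧
      ∀ z ∈ disk, F z = (f (mobius a z) - f a) / ((1 - (‖a‖ : ℂ) ^ 2) * deriv h a) := by
  obtain ⟨F, hF𝓕, hFeq⟩ := hF.linear f hf 0 a ha
  have hFz : ∀ z ∈ disk,
      F z = (f (mobius a z) - f a) / ((1 - (‖a‖ : ℂ) ^ 2) * deriv h a) := by
    intro z hz
    rw [hFeq hz]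
    simp [koebeTransform, mobius, hr.dz_eq ha]
  refine ⟨F, hF𝓕, ⟨analyticOnNhd_transport hr.analytic_left _ ha,
    analyticOnNhd_transport hr.analytic_right _ ha, by simp [transport, mobius_zero], ?_⟩, hFz⟩
  intro z hz
  rw [hFz z hz, hr.eq_add_conj _ (mobius_mem_disk ha hz), hr.eq_add_conj _ ha]
  -- Dividing `conj g` by a constant divides `g` by its conjugate, which is why the normalizer of
  -- `g` contains `conj (deriv h a)`.
  simp only [transport, map_div₀, map_sub, map_mul, map_pow, map_one, Complex.conj_ofReal,
    Complex.conj_conj]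
  ring

/-- The order bound, applied to the Koebe transforms of `f`. -/
theorem norm_jacobian_deriv_le (hF : IsAffineLinearInvariant 𝓕) (ho : upperOrder 𝓕 ≤ 5 / 2)
    (hf : f ∈ 𝓕) (hr : IsCanonicalRep f h g) {a : ℂ} (ha : a ∈ disk) :
    ‖(1 - (‖a‖ : ℂ) ^ 2) *
        (deriv (deriv h) a * conj (deriv h a) - deriv (deriv g) a * conj (deriv g a)) -
      2 * conj a * ((‖deriv h a‖ : ℂ) ^ 2 - (‖deriv g a‖ : ℂ) ^ 2)‖ ≤
      5 * (‖deriv h a‖ ^ 2 - ‖deriv g a‖ ^ 2) := by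
  obtain ⟨F, hF𝓕, hFr, -⟩ := exists_koebe hF hf hr ha
  have hb := norm_coeff_le_of_upperOrder_le ho hF𝓕 hFr
  have hlt := hr.norm_deriv_lt (hF.normalized f hf) ha
  have h0 := hr.deriv_ne_zero (hF.normalized f hf) ha
  have hc0 : conj (deriv h a) ≠ 0 := by simpa using h0
  have hs := one_sub_norm_sq_ne_zero ha
  simp only [coeff_one, coeff_two, deriv_transport_zero hr.analytic_right _ ha, deriv_deriv_transport_zero hr.analytic_left _ ha,
    deriv_deriv_transport_zero hr.analytic_right _ ha] at hb
  have hp : 0 < ‖deriv h a‖ := norm_pos_iff.2 h0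
  rw [mul_div_mul_left _ _ hs, mul_div_mul_left _ _ hs, mul_div_mul_left _ _ hs, norm_div,
    RCLike.norm_conj, div_pow, one_sub_div (by positivity)] at hb
  -- The term `h'' conj h' - g'' conj g'` is `∂J/∂z` at `a`; after division by `1 - |b₁|² = J/|h'|²`
  -- the order bound speaks only of `J` and `∂J/∂z`.
  have e : ((1 - (‖a‖ : ℂ) ^ 2) * deriv (deriv h) a - 2 * conj a * deriv h a) / deriv h a / 2 -
      conj (deriv g a / conj (deriv h a)) *
        (((1 - (‖a‖ : ℂ) ^ 2) * deriv (deriv g) a - 2 * conj a * deriv g a) /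
          conj (deriv h a) / 2) =
      ((1 - (‖a‖ : ℂ) ^ 2) *
        (deriv (deriv h) a * conj (deriv h a) - deriv (deriv g) a * conj (deriv g a)) -
      2 * conj a * ((‖deriv h a‖ : ℂ) ^ 2 - (‖deriv g a‖ : ℂ) ^ 2)) /
        (2 * (‖deriv h a‖ : ℂ) ^ 2) := by
    rw [← Complex.mul_conj' (deriv h a), ← Complex.mul_conj' (deriv g a), map_div₀, Complex.conj_conj]
    field_simp
    ring
  rw [e, norm_div, norm_mul, norm_pow, Complex.norm_real, norm_norm, Complex.norm_ofNat,
    div_div, div_le_iff₀] at hb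
  · refine hb.trans (le_of_eq ?_)
    field_simp
  · have : 0 < ‖deriv h a‖ ^ 2 - ‖deriv g a‖ ^ 2 := by nlinarith [norm_nonneg (deriv g a)]
    positivity

/-! ### Distortion of the Jacobian -/

/-- The Jacobian `|h'|² - |g'|²` of `h + conj g`. -/
noncomputable def jac (h g : ℂ → ℂ) (z : ℂ) : ℝ := ‖deriv h z‖ ^ 2 - ‖deriv g z‖ ^ 2

theorem hasDerivAt_norm_sq_deriv_ray {p : ℂ → ℂ} (hp : AnalyticOnNhd ℂ p disk) {u : ℂ} {t : ℝ}
    (hz : (t * u : ℂ) ∈ disk) :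
    HasDerivAt (fun s : ℝ => ‖deriv p (s * u)‖ ^ 2)
      (2 * (deriv (deriv p) (t * u) * conj (deriv p (t * u)) * u).re) t := by
  have h1 : HasDerivAt (fun s : ℂ => s * u) u (t : ℂ) := by
    simpa using (hasDerivAt_id' (t : ℂ)).mul_const u
  have h2 := (hp.deriv _ hz).differentiableAt.hasDerivAt.comp (t : ℂ) h1
  have h3 := h2.comp_ofReal.norm_sq
  refine h3.congr_deriv ?_
  rw [Complex.inner]
  simp only [Function.comp]
  congr 2
  ring

theorem ofReal_mul_mem_disk {u : ℂ} (hu : ‖u‖ = 1) {t : ℝ} (ht : t ∈ Ico (0 : ℝ) 1) :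
    (t * u : ℂ) ∈ disk := by
  rw [mem_disk, norm_mul, hu, Complex.norm_real, Real.norm_of_nonneg ht.1, mul_one]
  exact ht.2

theorem exists_hasDerivAt_jac_ray (hF : IsAffineLinearInvariant 𝓕) (ho : upperOrder 𝓕 ≤ 5 / 2)
    (hf : f ∈ 𝓕) (hr : IsCanonicalRep f h g) {u : ℂ} (hu : ‖u‖ = 1) {t : ℝ}
    (ht : t ∈ Ico (0 : ℝ) 1) :
    ∃ J' : ℝ, HasDerivAt (fun s : ℝ => jac h g (s * u)) J' t ∧
      |(1 - t ^ 2) * J' / 2 - 2 * t * jac h g (t * u)| ≤ 5 * jac h g (t * u) := by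
  have hz := ofReal_mul_mem_disk hu ht
  refine ⟨_, (hasDerivAt_norm_sq_deriv_ray hr.analytic_left hz).sub
    (hasDerivAt_norm_sq_deriv_ray hr.analytic_right hz), ?_⟩
  have hb := norm_jacobian_deriv_le hF ho hf hr hz
  have hn : ‖(t * u : ℂ)‖ = t := by
    rw [norm_mul, hu, Complex.norm_real, Real.norm_of_nonneg ht.1, mul_one]
  have hJ : ((‖deriv h (t * u)‖ : ℂ) ^ 2 - (‖deriv g (t * u)‖ : ℂ) ^ 2) =
      ((jac h g (t * u) : ℝ) : ℂ) := by simp [jac]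
  rw [hn, hJ] at hb
  refine le_trans ?_ hb
  have huu : conj u * u = 1 := by rw [Complex.conj_mul', hu]; simp
  set A := deriv (deriv h) (t * u) * conj (deriv h (t * u))
  set B := deriv (deriv g) (t * u) * conj (deriv g (t * u))
  -- Multiplication by the unit `u` keeps the norm, turns `conj (t * u)` into the real number `t`,
  -- and makes the real part of `∂J/∂z` half the radial derivative of `J`.
  have e : ((1 - (t : ℂ) ^ 2) * (A - B) - 2 * conj (t * u : ℂ) * (jac h g (t * u) : ℝ)) * u =
      ((1 - t ^ 2 : ℝ) : ℂ) * (A * u - B * u) - ((2 * t * jac h g (t * u) : ℝ) : ℂ) := by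
    push_cast
    rw [map_mul, Complex.conj_ofReal]
    linear_combination (-2 * (t : ℂ) * (jac h g (t * u) : ℝ)) * huu
  calc _ = |(((1 - (t : ℂ) ^ 2) * (A - B) -
          2 * conj (t * u : ℂ) * (jac h g (t * u) : ℝ)) * u).re| := by
        rw [e, Complex.sub_re, Complex.re_ofReal_mul, Complex.ofReal_re, Complex.sub_re]
        congr 1
        ring
    _ ≤ _ := (Complex.abs_re_le_norm _).trans_eq (by rw [norm_mul, hu, mul_one])

/-- The differential inequality reads `(log J)' ≥ (4t - 10)/(1 - t²)`. The right side is the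
logarithmic derivative of `(1-t)³/(1+t)⁷`, so the quotient of `J` by this function increases along
the ray. -/
theorem jac_ray_lower (hF : IsAffineLinearInvariant 𝓕) (ho : upperOrder 𝓕 ≤ 5 / 2)
    (hf : f ∈ 𝓕) (hr : IsCanonicalRep f h g) {u : ℂ} (hu : ‖u‖ = 1) {t : ℝ}
    (ht : t ∈ Ico (0 : ℝ) 1) :
    jac h g 0 * ((1 - t) ^ 3 / (1 + t) ^ 7) ≤ jac h g (t * u) := by
  choose! J' hJ' hb using fun s (hs : s ∈ Ico (0 : ℝ) 1) =>
    exists_hasDerivAt_jac_ray hF ho hf hr hu hs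
  have hd : ∀ s ∈ Ico (0 : ℝ) 1, HasDerivAt
      (fun s : ℝ => jac h g (s * u) * ((1 + s) ^ 7 / (1 - s) ^ 3))
      ((1 + s) ^ 6 / (1 - s) ^ 4 * (J' s * (1 - s ^ 2) + jac h g (s * u) * (10 - 4 * s))) s := by
    intro s hs
    have hs1 : 1 - s ≠ 0 := (sub_pos.2 hs.2).ne'
    have h1 : HasDerivAt (fun s : ℝ => (1 + s) ^ 7) (7 * (1 + s) ^ 6) s := by
      simpa using ((hasDerivAt_id' s).const_add 1).fun_pow 7
    have h2 : HasDerivAt (fun s : ℝ => (1 - s) ^ 3) (-(3 * (1 - s) ^ 2)) s := by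
      simpa using ((hasDerivAt_id' s).const_sub 1).fun_pow 3
    refine ((hJ' s hs).mul (h1.div h2 (pow_ne_zero 3 hs1))).congr_deriv ?_
    simp only [Pi.div_apply]
    field_simp
    ring
  have hm : MonotoneOn (fun s : ℝ => jac h g (s * u) * ((1 + s) ^ 7 / (1 - s) ^ 3))
      (Ico 0 1) := by
    refine monotoneOn_of_deriv_nonneg (convex_Ico 0 1)
      (fun s hs => (hd s hs).continuousAt.continuousWithinAt)
      (fun s hs => (hd s (interior_subset hs)).differentiableAt.differentiableWithinAt) ?_
    intro s hs
    have hs' := interior_subset hs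
    rw [(hd s hs').deriv]
    have := (abs_le.1 (hb s hs')).1
    have h1 : 0 < 1 - s := sub_pos.2 hs'.2
    have h2 : 0 < 1 + s := by linarith [hs'.1]
    exact mul_nonneg (by positivity) (by linarith)
  have := hm ⟨le_rfl, one_pos⟩ ht ht.1
  have h1 : 0 < 1 - t := sub_pos.2 ht.2
  have h2 : 0 < 1 + t := by linarith [ht.1]
  simp only [Complex.ofReal_zero, zero_mul, add_zero, sub_zero, one_pow, div_one, mul_one] at this
  rw [← mul_div_assoc, div_le_iff₀ (by positivity)]
  rwa [← mul_div_assoc, le_div_iff₀ (by positivity)] at this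

theorem jac_ray_upper (hF : IsAffineLinearInvariant 𝓕) (ho : upperOrder 𝓕 ≤ 5 / 2)
    (hf : f ∈ 𝓕) (hr : IsCanonicalRep f h g) {u : ℂ} (hu : ‖u‖ = 1) {t : ℝ}
    (ht : t ∈ Ico (0 : ℝ) 1) :
    jac h g (t * u) ≤ jac h g 0 * ((1 + t) ^ 3 / (1 - t) ^ 7) := by
  choose! J' hJ' hb using fun s (hs : s ∈ Ico (0 : ℝ) 1) =>
    exists_hasDerivAt_jac_ray hF ho hf hr hu hs
  have hd : ∀ s ∈ Ico (0 : ℝ) 1, HasDerivAt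
      (fun s : ℝ => jac h g (s * u) * ((1 - s) ^ 7 / (1 + s) ^ 3))
      ((1 - s) ^ 6 / (1 + s) ^ 4 * (J' s * (1 - s ^ 2) - jac h g (s * u) * (10 + 4 * s))) s := by
    intro s hs
    have hs1 : 1 + s ≠ 0 := by linarith [hs.1]
    have h1 : HasDerivAt (fun s : ℝ => (1 + s) ^ 3) (3 * (1 + s) ^ 2) s := by
      simpa using ((hasDerivAt_id' s).const_add 1).fun_pow 3
    have h2 : HasDerivAt (fun s : ℝ => (1 - s) ^ 7) (-(7 * (1 - s) ^ 6)) s := by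
      simpa using ((hasDerivAt_id' s).const_sub 1).fun_pow 7
    refine ((hJ' s hs).mul (h2.div h1 (pow_ne_zero 3 hs1))).congr_deriv ?_
    simp only [Pi.div_apply]
    field_simp
    ring
  have hm : AntitoneOn (fun s : ℝ => jac h g (s * u) * ((1 - s) ^ 7 / (1 + s) ^ 3))
      (Ico 0 1) := by
    refine antitoneOn_of_deriv_nonpos (convex_Ico 0 1)
      (fun s hs => (hd s hs).continuousAt.continuousWithinAt)
      (fun s hs => (hd s (interior_subset hs)).differentiableAt.differentiableWithinAt) ?_
    intro s hs
    have hs' := interior_subset hs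
    rw [(hd s hs').deriv]
    have := (abs_le.1 (hb s hs')).2
    have h1 : 0 < 1 - s := sub_pos.2 hs'.2
    have h2 : 0 < 1 + s := by linarith [hs'.1]
    exact mul_nonpos_of_nonneg_of_nonpos (by positivity) (by linarith)
  have := hm ⟨le_rfl, one_pos⟩ ht ht.1
  have h1 : 0 < 1 - t := sub_pos.2 ht.2
  have h2 : 0 < 1 + t := by linarith [ht.1]
  simp only [Complex.ofReal_zero, zero_mul, add_zero, sub_zero, one_pow, div_one, mul_one] at this
  rw [← mul_div_assoc, le_div_iff₀ (by positivity)]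
  rwa [← mul_div_assoc, div_le_iff₀ (by positivity)] at this

theorem exists_unit_mul (z : ℂ) : ∃ u : ℂ, ‖u‖ = 1 ∧ (‖z‖ : ℂ) * u = z := by
  rcases eq_or_ne z 0 with rfl | hz
  · exact ⟨1, by simp⟩
  · have : (‖z‖ : ℂ) ≠ 0 := by simpa using hz
    exact ⟨z / ‖z‖, by simp [hz], by field_simp⟩

theorem jac_lower (hF : IsAffineLinearInvariant 𝓕) (ho : upperOrder 𝓕 ≤ 5 / 2)
    (hf : f ∈ 𝓕) (hr : IsCanonicalRep f h g) {z : ℂ} (hz : z ∈ disk) :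
    jac h g 0 * ((1 - ‖z‖) ^ 3 / (1 + ‖z‖) ^ 7) ≤ jac h g z := by
  obtain ⟨u, hu, e⟩ := exists_unit_mul z
  simpa [e] using jac_ray_lower hF ho hf hr hu ⟨norm_nonneg z, mem_disk.1 hz⟩

theorem jac_upper (hF : IsAffineLinearInvariant 𝓕) (ho : upperOrder 𝓕 ≤ 5 / 2)
    (hf : f ∈ 𝓕) (hr : IsCanonicalRep f h g) {z : ℂ} (hz : z ∈ disk) :
    jac h g z ≤ jac h g 0 * ((1 + ‖z‖) ^ 3 / (1 - ‖z‖) ^ 7) := by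
  obtain ⟨u, hu, e⟩ := exists_unit_mul z
  simpa [e] using jac_ray_upper hF ho hf hr hu ⟨norm_nonneg z, mem_disk.1 hz⟩

/-! ### The dilatation -/

/-- By the preceding identity `1 - |mobius b k|²` equals `(1-|b|²)(1-|k|²)/|1 + conj b k|²`, and
this is smallest when the denominator reaches `(1+|k||b|)²`. -/
theorem norm_mobius_mul_le {b k : ℂ} (hb : b ∈ disk) (hk : k ∈ disk) :
    ‖mobius b k‖ * (1 + ‖k‖ * ‖b‖) ≤ ‖k‖ + ‖b‖ := by
  have h0 := norm_pos_iff.2 (one_add_conj_mul_ne_zero hb hk)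
  have key := norm_one_add_conj_mul_sq_sub b k
  have hle : ‖1 + conj b * k‖ ≤ 1 + ‖k‖ * ‖b‖ := by
    refine (norm_add_le _ _).trans ?_
    simp [mul_comm]
  rw [mem_disk] at hb hk
  have hb0 := norm_nonneg b
  have hk0 := norm_nonneg k
  have hP : 0 ≤ (1 - ‖b‖ ^ 2) * (1 - ‖k‖ ^ 2) := by
    apply mul_nonneg <;> nlinarith
  rw [mobius, norm_div, div_mul_eq_mul_div, div_le_iff₀ h0]
  refine le_of_sq_le_sq ?_ (by positivity)
  have e1 : ‖k + b‖ ^ 2 = ‖1 + conj b * k‖ ^ 2 - (1 - ‖b‖ ^ 2) * (1 - ‖k‖ ^ 2) := by linarith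
  have e2 : ‖1 + conj b * k‖ ^ 2 ≤ (1 + ‖k‖ * ‖b‖) ^ 2 := by gcongr
  rw [mul_pow, mul_pow, e1]
  nlinarith [mul_nonneg hP (sub_nonneg.2 e2)]

/-- Schwarz's lemma applies to `w` followed by the automorphism that moves `w 0` to the origin;
undoing the automorphism costs `norm_mobius_mul_le`. -/
theorem norm_mul_le_of_mapsTo_disk {w : ℂ → ℂ} (hd : DifferentiableOn ℂ w disk)
    (hw : MapsTo w disk disk) {z : ℂ} (hz : z ∈ disk) :
    ‖w z‖ * (1 + ‖z‖ * ‖w 0‖) ≤ ‖z‖ + ‖w 0‖ := by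
  have hb : w 0 ∈ disk := hw zero_mem_disk
  have hb' : -w 0 ∈ disk := by simpa [mem_disk] using hb
  have hkd : DifferentiableOn ℂ (fun x => mobius (-w 0) (w x)) disk := fun x hx =>
    ((hasDerivAt_mobius hb' (hw hx)).differentiableAt).comp_differentiableWithinAt x (hd x hx)
  have hk : MapsTo (fun x => mobius (-w 0) (w x)) disk disk := fun x hx =>
    mobius_mem_disk hb' (hw hx)
  have hs : ‖mobius (-w 0) (w z)‖ ≤ ‖z‖ :=
    Complex.norm_le_norm_of_mapsTo_ball hkd (hk.mono_right ball_subset_closedBall)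
      (by simp [mobius]) (mem_disk.1 hz)
  have h1 := norm_mobius_mul_le hb (hk hz)
  simp only [mobius_neg_mobius hb (hw hz)] at h1
  have hw1 := mem_disk.1 (hw hz)
  have hb1 := mem_disk.1 hb
  have hwb : ‖w z‖ * ‖w 0‖ ≤ 1 := by nlinarith [norm_nonneg (w z), norm_nonneg (w 0)]
  nlinarith [mul_nonneg (sub_nonneg.2 hs) (sub_nonneg.2 hwb)]

/-- The Schwarz–Pick bound for the dilatation `g' / h'`, cleared of denominators. -/
theorem IsCanonicalRep.norm_deriv_mul_le (hr : IsCanonicalRep f h g) (hf : IsNormalizedMapping f)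
    {z : ℂ} (hz : z ∈ disk) :
    ‖deriv g z‖ * (1 + ‖z‖ * ‖deriv g 0‖) ≤ (‖z‖ + ‖deriv g 0‖) * ‖deriv h z‖ := by
  have hd : DifferentiableOn ℂ (fun x => deriv g x / deriv h x) disk := fun x hx =>
    ((hr.analytic_right.deriv x hx).differentiableAt.div
      (hr.analytic_left.deriv x hx).differentiableAt
      (hr.deriv_ne_zero hf hx)).differentiableWithinAt
  have hw : MapsTo (fun x => deriv g x / deriv h x) disk disk := fun x hx => by
    rw [mem_disk, norm_div, div_lt_one (norm_pos_iff.2 (hr.deriv_ne_zero hf hx))]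
    exact hr.norm_deriv_lt hf hx
  have h1 : deriv h 0 = 1 := by rw [← hr.dz_eq zero_mem_disk, hf.dz_zero]
  have := norm_mul_le_of_mapsTo_disk hd hw hz
  simp only [h1, div_one, norm_div] at this
  have hp := norm_pos_iff.2 (hr.deriv_ne_zero hf hz)
  rwa [div_mul_eq_mul_div, div_le_iff₀ hp] at this

theorem IsCanonicalRep.jac_zero (hr : IsCanonicalRep f h g) (hf : IsNormalizedMapping f) :
    jac h g 0 = 1 - ‖deriv g 0‖ ^ 2 := by
  rw [jac, ← hr.dz_eq zero_mem_disk, hf.dz_zero]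
  simp

/-! ### Distortion of the derivatives -/

/-- With `H = |h'|` and `G = |g'|`, one has `(H-G)² = (H-G)/(H+G) · J`. Schwarz–Pick bounds the
first factor below, `jac_lower` the second, and the product of the two bounds is a perfect square.
-/
theorem norm_deriv_sub_lower (hF : IsAffineLinearInvariant 𝓕) (ho : upperOrder 𝓕 ≤ 5 / 2)
    (hf : f ∈ 𝓕) (hr : IsCanonicalRep f h g) {z : ℂ} (hz : z ∈ disk) :
    (1 - ‖deriv g 0‖) * ((1 - ‖z‖) ^ 2 / (1 + ‖z‖) ^ 4) ≤ ‖deriv h z‖ - ‖deriv g z‖ := by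
  have hn := hF.normalized f hf
  have hJ := jac_lower hF ho hf hr hz
  have hS := hr.norm_deriv_mul_le hn hz
  have hlt := hr.norm_deriv_lt hn hz
  rw [hr.jac_zero hn, jac] at hJ
  have hb : ‖deriv g 0‖ < 1 := by
    have := hr.norm_deriv_lt hn zero_mem_disk
    rwa [← hr.dz_eq zero_mem_disk, hn.dz_zero, norm_one] at this
  rw [mem_disk] at hz
  have hb0 := norm_nonneg (deriv g 0)
  have hz0 := norm_nonneg z
  have hg0 := norm_nonneg (deriv g z)
  generalize ‖deriv g 0‖ = b at *
  generalize ‖deriv g z‖ = G at *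
  generalize ‖deriv h z‖ = H at *
  generalize ‖z‖ = t at *
  have hHG : 0 < H + G := by linarith
  have h1t : 0 < 1 - t := by linarith
  have hS' : (1 - b) * (1 - t) * (H + G) ≤ (1 + b) * (1 + t) * (H - G) := by nlinarith
  have hS2 : (1 - b) * (1 - t) / ((1 + b) * (1 + t)) * (H + G) ≤ H - G := by
    rw [div_mul_eq_mul_div, div_le_iff₀ (by positivity)]
    linarith
  refine le_of_sq_le_sq ?_ (by linarith)
  have hc : 0 ≤ (1 - b) * (1 - t) / ((1 + b) * (1 + t)) :=
    div_nonneg (mul_nonneg (by linarith) h1t.le) (by positivity)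
  calc ((1 - b) * ((1 - t) ^ 2 / (1 + t) ^ 4)) ^ 2
      = (1 - b) * (1 - t) / ((1 + b) * (1 + t)) *
        ((1 - b ^ 2) * ((1 - t) ^ 3 / (1 + t) ^ 7)) := by
        field_simp
        ring
    _ ≤ (1 - b) * (1 - t) / ((1 + b) * (1 + t)) * (H ^ 2 - G ^ 2) := by gcongr
    _ = (1 - b) * (1 - t) / ((1 + b) * (1 + t)) * (H + G) * (H - G) := by ring
    _ ≤ (H - G) * (H - G) := mul_le_mul_of_nonneg_right hS2 (by linarith)
    _ = (H - G) ^ 2 := by ring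

/-- When `g'(0) = 0`, Schwarz gives `|g'| ≤ |z||h'|`, hence `J ≥ (1-|z|²)|h'|²`, to be compared with
`jac_upper`. -/
theorem norm_deriv_left_upper (hF : IsAffineLinearInvariant 𝓕) (ho : upperOrder 𝓕 ≤ 5 / 2)
    (hf : f ∈ 𝓕) (hr : IsCanonicalRep f h g) (h0 : deriv g 0 = 0) {z : ℂ} (hz : z ∈ disk) :
    ‖deriv h z‖ ≤ (1 + ‖z‖) / (1 - ‖z‖) ^ 4 := by
  have hn := hF.normalized f hf
  have hJ := jac_upper hF ho hf hr hz
  have hS := hr.norm_deriv_mul_le hn hz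
  rw [hr.jac_zero hn, jac] at hJ
  simp only [h0, norm_zero, mul_zero, add_zero, mul_one] at hS hJ
  rw [mem_disk] at hz
  have hz0 := norm_nonneg z
  have hg0 := norm_nonneg (deriv g z)
  have hh0 := norm_nonneg (deriv h z)
  generalize ‖deriv g z‖ = G at *
  generalize ‖deriv h z‖ = H at *
  generalize ‖z‖ = t at *
  have h1t : 0 < 1 - t := by linarith
  refine le_of_sq_le_sq ?_ (by positivity)
  have h2 : H ^ 2 * (1 - t ^ 2) ≤ H ^ 2 - G ^ 2 := by nlinarith [mul_nonneg hz0 hh0]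
  have h3 : 0 < 1 - t ^ 2 := by nlinarith
  calc H ^ 2 ≤ ((1 + t) ^ 3 / (1 - t) ^ 7) / (1 - t ^ 2) := by
        rw [le_div_iff₀ h3]
        linarith
    _ = ((1 + t) / (1 - t) ^ 4) ^ 2 := by
        rw [show 1 - t ^ 2 = (1 - t) * (1 + t) by ring]
        field_simp

theorem norm_deriv_right_upper (hF : IsAffineLinearInvariant 𝓕) (ho : upperOrder 𝓕 ≤ 5 / 2)
    (hf : f ∈ 𝓕) (hr : IsCanonicalRep f h g) (h0 : deriv g 0 = 0) {z : ℂ} (hz : z ∈ disk) :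
    ‖deriv g z‖ ≤ ‖z‖ * ((1 + ‖z‖) / (1 - ‖z‖) ^ 4) := by
  have hS := hr.norm_deriv_mul_le (hF.normalized f hf) hz
  simp only [h0, norm_zero, mul_zero, add_zero, mul_one] at hS
  exact hS.trans (mul_le_mul_of_nonneg_left (norm_deriv_left_upper hF ho hf hr h0 hz)
    (norm_nonneg z))

/-! ### Growth of injective maps -/

section Growth

variable {f : ℂ → ℂ} {f' : ℂ → ℂ →L[ℝ] ℂ} {M M' : ℝ → ℝ}

theorem exists_equiv_of_expanding {L : ℂ →L[ℝ] ℂ} {c : ℝ} (hc : 0 < c)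
    (hL : ∀ v, c * ‖v‖ ≤ ‖L v‖) : ∃ e : ℂ ≃L[ℝ] ℂ, (e : ℂ →L[ℝ] ℂ) = L := by
  have hker : ∀ v, L v = 0 → v = 0 := by
    intro v hv
    have := hL v
    rw [hv, norm_zero] at this
    exact norm_eq_zero.1 (le_antisymm (by nlinarith [norm_nonneg v]) (norm_nonneg v))
  have hk : LinearMap.ker (L : ℂ →ₗ[ℝ] ℂ) = ⊥ := LinearMap.ker_eq_bot'.2 hker
  have hrg : LinearMap.range (L : ℂ →ₗ[ℝ] ℂ) = ⊤ :=
    LinearMap.range_eq_top.2 (LinearMap.injective_iff_surjective.1 (LinearMap.ker_eq_bot.1 hk))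
  exact ⟨ContinuousLinearEquiv.ofBijective L hk hrg,
    ContinuousLinearEquiv.coe_ofBijective L hk hrg⟩

theorem isOpen_image_of_map_nhds {U : Set ℂ} (hU : IsOpen U)
    (hf : ∀ z ∈ U, map f (𝓝 z) = 𝓝 (f z)) : IsOpen (f '' U) := by
  rw [isOpen_iff_mem_nhds]
  rintro _ ⟨z, hz, rfl⟩
  rw [← hf z hz]
  exact image_mem_map (hU.mem_nhds hz)

theorem invFunOn_apply_of_injOn (hinj : InjOn f disk) {z : ℂ} (hz : z ∈ disk) :
    Function.invFunOn f disk (f z) = z :=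
  hinj.leftInvOn_invFunOn hz

theorem hasFDerivAt_invFunOn (hinj : InjOn f disk) {z : ℂ} (hz : z ∈ disk) {e : ℂ ≃L[ℝ] ℂ}
    (he : HasStrictFDerivAt f (e : ℂ →L[ℝ] ℂ) z) :
    HasFDerivAt (Function.invFunOn f disk) (e.symm : ℂ →L[ℝ] ℂ) (f z) := by
  have hm := he.map_nhds_eq_of_equiv
  have hΦ := invFunOn_apply_of_injOn hinj hz
  refine HasFDerivAt.of_local_left_inverse ?_ (by rw [hΦ]; exact he.hasFDerivAt) ?_
  · intro s hs
    rw [hΦ] at hs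
    rw [mem_map, ← hm]
    refine mem_of_superset (image_mem_map (inter_mem hs (disk_mem_nhds hz))) ?_
    rintro _ ⟨w, hw, rfl⟩
    rw [mem_preimage, invFunOn_apply_of_injOn hinj hw.2]
    exact hw.1
  · rw [← hm]
    refine mem_of_superset (image_mem_map (disk_mem_nhds hz)) ?_
    rintro _ ⟨w, hw, rfl⟩
    exact congrArg f (invFunOn_apply_of_injOn hinj hw)

/-- The image of the open ball is open, and it is closed relative to `ball 0 δ`: a limit of image
points is attained on the closed ball, and the bounding circle only has values of norm at least `δ`.
Connectedness of `ball 0 δ` does the rest. -/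
theorem ball_subset_image_ball {r δ : ℝ} (hr0 : 0 < r) (hcont : ContinuousOn f (closedBall 0 r))
    (hopen : IsOpen (f '' ball 0 r)) (h0 : f 0 = 0) (hδ0 : 0 < δ)
    (hδ : ∀ z ∈ sphere (0 : ℂ) r, δ ≤ ‖f z‖) : ball 0 δ ⊆ f '' ball 0 r := by
  refine (convex_ball (0 : ℂ) δ).isPreconnected.subset_of_closure_inter_subset hopen
    ⟨0, mem_ball_self hδ0, 0, mem_ball_self hr0, h0⟩ ?_
  rintro w ⟨hw, hwδ⟩
  have hcl : closure (f '' ball 0 r) ⊆ f '' closedBall 0 r :=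
    closure_minimal (image_mono ball_subset_closedBall)
      ((isCompact_closedBall 0 r).image_of_continuousOn hcont).isClosed
  obtain ⟨z, hz, rfl⟩ := hcl hw
  refine ⟨z, ?_, rfl⟩
  rw [mem_closedBall_zero_iff] at hz
  rw [mem_ball_zero_iff] at hwδ ⊢
  refine lt_of_le_of_ne hz fun e => ?_
  exact (hδ z (mem_sphere_zero_iff_norm.2 e)).not_gt hwδ

theorem hasDerivAt_norm_of_ne_zero {γ : ℝ → ℂ} {γ' : ℂ} {t : ℝ} (hγ : HasDerivAt γ γ' t)
    (h0 : γ t ≠ 0) : ∃ N', HasDerivAt (fun s => ‖γ s‖) N' t ∧ N' ≤ ‖γ'‖ := by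
  have hp := norm_pos_iff.2 h0
  have h1 := hγ.norm_sq.sqrt (pow_ne_zero 2 hp.ne')
  simp only [Real.sqrt_sq (norm_nonneg _)] at h1
  refine ⟨_, h1, ?_⟩
  rw [mul_div_mul_left _ _ two_ne_zero, div_le_iff₀ hp, mul_comm ‖γ'‖]
  exact real_inner_le_norm _ _

/-- An injective local diffeomorphism of the disk fixing the origin whose differential at `z`
expands by at least `M'(|z|)` satisfies `M(|z|) ≤ |f(z)|`, if `M(0) = 0`. -/
theorem le_norm_of_injOn (hf : ∀ z ∈ disk, HasStrictFDerivAt f (f' z) z) (hinj : InjOn f disk)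
    (h0 : f 0 = 0) (hM : ∀ t ∈ Ico (0 : ℝ) 1, HasDerivAt M (M' t) t) (hM0 : M 0 = 0)
    (hpos : ∀ t ∈ Ico (0 : ℝ) 1, 0 < M' t)
    (hle : ∀ z ∈ disk, ∀ v, M' ‖z‖ * ‖v‖ ≤ ‖f' z v‖) {z : ℂ} (hz : z ∈ disk) :
    M ‖z‖ ≤ ‖f z‖ := by
  rcases eq_or_ne z 0 with rfl | hz0
  · simp [hM0]
  have hIco : ∀ w ∈ disk, ‖w‖ ∈ Ico (0 : ℝ) 1 := fun w hw => ⟨norm_nonneg w, mem_disk.1 hw⟩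
  choose! e he using fun w (hw : w ∈ disk) =>
    exists_equiv_of_expanding (hpos _ (hIco w hw)) (hle w hw)
  have hfe : ∀ w ∈ disk, HasStrictFDerivAt f (e w : ℂ →L[ℝ] ℂ) w := fun w hw => by
    rw [he w hw]; exact hf w hw
  have hr0 : 0 < ‖z‖ := norm_pos_iff.2 hz0
  have hr1 : ‖z‖ < 1 := mem_disk.1 hz
  have hcb : closedBall (0 : ℂ) ‖z‖ ⊆ disk := closedBall_subset_ball hr1
  have hcont : ContinuousOn f disk := fun w hw =>
    (hf w hw).hasFDerivAt.continuousAt.continuousWithinAt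
  -- Minimality of `|f z₁|` on the circle is what keeps the half-open segment from `0` to `f z₁`
  -- inside the image of the open ball.
  obtain ⟨z₁, hz₁, hmin⟩ := (isCompact_sphere (0 : ℂ) ‖z‖).exists_isMinOn
    ⟨z, mem_sphere_zero_iff_norm.2 rfl⟩
    ((hcont.mono (sphere_subset_closedBall.trans hcb)).norm)
  have hn₁ : ‖z₁‖ = ‖z‖ := mem_sphere_zero_iff_norm.1 hz₁
  have hz₁d : z₁ ∈ disk := mem_disk.2 (hn₁ ▸ hr1)
  have hf₁ : f z₁ ≠ 0 := fun e0 => by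
    have := hinj hz₁d zero_mem_disk (e0.trans h0.symm)
    rw [this, norm_zero] at hn₁
    exact hr0.ne hn₁
  refine le_trans ?_ (hmin (mem_sphere_zero_iff_norm.2 rfl : z ∈ sphere (0 : ℂ) ‖z‖))
  have hδ0 : 0 < ‖f z₁‖ := norm_pos_iff.2 hf₁
  have hsub : ball 0 ‖f z₁‖ ⊆ f '' ball 0 ‖z‖ :=
    ball_subset_image_ball hr0 (hcont.mono hcb) (isOpen_image_of_map_nhds isOpen_ball
      fun w hw => (hfe w (hcb (ball_subset_closedBall hw))).map_nhds_eq_of_equiv) h0 hδ0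
      fun w hw => hmin hw
  set Φ := Function.invFunOn f disk
  have hseg : ∀ t ∈ Icc (0 : ℝ) 1, ∃ w ∈ disk, f w = t * f z₁ := by
    intro t ht
    rcases ht.2.eq_or_lt with rfl | ht1
    · exact ⟨z₁, hz₁d, by simp⟩
    · obtain ⟨w, hw, hw'⟩ := hsub (show (t * f z₁ : ℂ) ∈ ball (0 : ℂ) ‖f z₁‖ by
        rw [mem_ball_zero_iff, norm_mul, Complex.norm_real, Real.norm_of_nonneg ht.1]
        nlinarith)
      exact ⟨w, hcb (ball_subset_closedBall hw), hw'⟩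
  have hγ : ∀ t ∈ Icc (0 : ℝ) 1, Φ (t * f z₁) ∈ disk ∧ f (Φ (t * f z₁)) = t * f z₁ ∧
      HasDerivAt (fun s : ℝ => Φ (s * f z₁)) ((e (Φ (t * f z₁))).symm (f z₁)) t := by
    intro t ht
    obtain ⟨w, hw, hfw⟩ := hseg t ht
    have hΦw : Φ (t * f z₁) = w := by rw [← hfw]; exact invFunOn_apply_of_injOn hinj hw
    refine ⟨hΦw ▸ hw, by rw [hΦw, hfw], ?_⟩
    have hd := hasFDerivAt_invFunOn hinj hw (hfe w hw)
    rw [hfw] at hd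
    have hl : HasDerivAt (fun s : ℝ => (s * f z₁ : ℂ)) (f z₁) t := by
      simpa using (Complex.ofRealCLM.hasDerivAt (x := t)).mul_const (f z₁)
    rw [hΦw]
    exact hd.comp_hasDerivAt t hl
  have hcontu : ContinuousOn (fun t : ℝ => M ‖Φ (t * f z₁)‖) (Icc 0 1) := fun t ht =>
    ((hM _ (hIco _ (hγ t ht).1)).continuousAt.comp (f := fun t : ℝ => ‖Φ (t * f z₁)‖)
      (hγ t ht).2.2.continuousAt.norm).continuousWithinAt
  -- On the pulled-back curve `γ`, expansion gives `M'(|γ|)|γ'| ≤ |f z₁|`. The endpoint `t = 0` is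
  -- left out because `γ` is then at the origin, where the norm is not differentiable.
  have hderiv : ∀ t ∈ Ioo (0 : ℝ) 1, ∃ u', HasDerivAt (fun t : ℝ => M ‖Φ (t * f z₁)‖) u' t ∧
      u' ≤ ‖f z₁‖ := by
    intro t ht
    obtain ⟨hd, hft, hder⟩ := hγ t (Ioo_subset_Icc_self ht)
    have hne : Φ (t * f z₁) ≠ 0 := fun e0 => by
      rw [e0, h0] at hft
      have : (t : ℂ) ≠ 0 := by exact_mod_cast ht.1.ne'
      exact mul_ne_zero this hf₁ hft.symm
    obtain ⟨N', hN, hN'⟩ := hasDerivAt_norm_of_ne_zero hder hne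
    refine ⟨_, (hM _ (hIco _ hd)).comp t hN, ?_⟩
    have h1 := hle _ hd ((e (Φ (t * f z₁))).symm (f z₁))
    rw [← he _ hd, ContinuousLinearEquiv.coe_coe, ContinuousLinearEquiv.apply_symm_apply] at h1
    exact (mul_le_mul_of_nonneg_left hN' (hpos _ (hIco _ hd)).le).trans h1
  have hmv := (convex_Icc (0 : ℝ) 1).image_sub_le_mul_sub_of_deriv_le hcontu
    (fun t ht => by
      rw [interior_Icc] at ht
      obtain ⟨u', hu, -⟩ := hderiv t ht
      exact hu.differentiableAt.differentiableWithinAt)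
    (C := ‖f z₁‖) (fun t ht => by
      rw [interior_Icc] at ht
      obtain ⟨u', hu, hu'⟩ := hderiv t ht
      rwa [hu.deriv]) 0 (by simp) 1 (by simp) zero_le_one
  have hΦ0 : Φ 0 = 0 := by
    have := invFunOn_apply_of_injOn hinj zero_mem_disk
    rwa [h0] at this
  have hΦ1 : Φ (f z₁) = z₁ := invFunOn_apply_of_injOn hinj hz₁d
  simpa [hΦ0, hΦ1, hM0, hn₁] using hmv

end Growth

/-! ### Growth and two-point distortion in an invariant family -/

/-- The integral of `(1 - t)² / (1 + t)⁴` from `0` to `r`. -/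
noncomputable def growthBound (r : ℝ) : ℝ := r * (1 + r ^ 2 / 3) / (1 + r) ^ 3

theorem hasDerivAt_growthBound {t : ℝ} (ht : 0 ≤ t) :
    HasDerivAt growthBound ((1 - t) ^ 2 / (1 + t) ^ 4) t := by
  have h0 : 1 + t ≠ 0 := by positivity
  have h1 : HasDerivAt (fun s : ℝ => (1 + s) ^ 3) (3 * (1 + t) ^ 2) t := by
    simpa using ((hasDerivAt_id' t).const_add 1).fun_pow 3
  have h2 : HasDerivAt (fun s : ℝ => 1 + s ^ 2 / 3) (2 * t / 3) t := by
    simpa using ((hasDerivAt_pow 2 t).div_const 3).const_add 1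
  refine HasDerivAt.congr_deriv (f := growthBound)
    (((hasDerivAt_id' t).mul h2).div h1 (pow_ne_zero 3 h0)) ?_
  field_simp
  simp
  ring

theorem growth_of_injOn (hF : IsAffineLinearInvariant 𝓕) (ho : upperOrder 𝓕 ≤ 5 / 2)
    (hf : f ∈ 𝓕) (hr : IsCanonicalRep f h g) (hinj : InjOn f disk) {z : ℂ} (hz : z ∈ disk) :
    (1 - ‖deriv g 0‖) * growthBound ‖z‖ ≤ ‖f z‖ := by
  have hn := hF.normalized f hf
  have hb : ‖deriv g 0‖ < 1 := by
    have := hr.norm_deriv_lt hn zero_mem_disk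
    rwa [← hr.dz_eq zero_mem_disk, hn.dz_zero, norm_one] at this
  refine le_norm_of_injOn (M := fun t => (1 - ‖deriv g 0‖) * growthBound t)
    (M' := fun t => (1 - ‖deriv g 0‖) * ((1 - t) ^ 2 / (1 + t) ^ 4))
    (fun z hz => hr.hasStrictFDerivAt hz) hinj hn.map_zero
    (fun t ht => (hasDerivAt_growthBound ht.1).const_mul _) (by simp [growthBound]) ?_ ?_ hz
  · intro t ht
    have h1 : 0 < 1 - t := sub_pos.2 ht.2
    have h2 : 0 < 1 + t := by linarith [ht.1]
    have h3 := sub_pos.2 hb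
    positivity
  · intro w hw v
    exact (mul_le_mul_of_nonneg_right (norm_deriv_sub_lower hF ho hf hr hw)
      (norm_nonneg v)).trans (norm_wirtingerMap_ge _ _ v)

/-- This is the growth estimate for the Koebe transform at `a`, evaluated at the point that the
automorphism sends to `z`. Its first co-analytic coefficient has modulus `|g'(a)|/|h'(a)|`, so the
transform's normalizer times `1 - |b₁|` produces `|h'(a)| - |g'(a)|`. -/
theorem norm_sub_ge_growthBound (hF : IsAffineLinearInvariant 𝓕) (ho : upperOrder 𝓕 ≤ 5 / 2)
    (hf : f ∈ 𝓕) (hr : IsCanonicalRep f h g) (hinj : InjOn f disk) {a z : ℂ} (ha : a ∈ disk)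
    (hz : z ∈ disk) :
    (1 - ‖a‖ ^ 2) * (‖deriv h a‖ - ‖deriv g a‖) * growthBound ‖mobius (-a) z‖ ≤ ‖f z - f a‖ := by
  obtain ⟨F, hF𝓕, hFr, hFz⟩ := exists_koebe hF hf hr ha
  have ha' : -a ∈ disk := by simpa [mem_disk] using ha
  have h0 := hr.deriv_ne_zero (hF.normalized f hf) ha
  have hs := one_sub_norm_sq_ne_zero ha
  have hc : (1 - (‖a‖ : ℂ) ^ 2) * deriv h a ≠ 0 := mul_ne_zero hs h0
  have hFinj : InjOn F disk := by
    intro z hz w hw e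
    rw [hFz z hz, hFz w hw, div_left_inj' hc, sub_left_inj] at e
    exact injOn_mobius ha hz hw (hinj (mobius_mem_disk ha hz) (mobius_mem_disk ha hw) e)
  have hk := mobius_mem_disk ha' hz
  have hg := growth_of_injOn hF ho hF𝓕 hFr hFinj hk
  rw [hFz _ hk, mobius_neg_mobius ha hz, deriv_transport_zero hr.analytic_right _ ha,
    mul_div_mul_left _ _ hs, norm_div, norm_div, RCLike.norm_conj] at hg
  have hs' : ‖(1 - (‖a‖ : ℂ) ^ 2)‖ = 1 - ‖a‖ ^ 2 := by
    have : (1 - (‖a‖ : ℂ) ^ 2) = ((1 - ‖a‖ ^ 2 : ℝ) : ℂ) := by push_cast; rfl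
    rw [this, Complex.norm_real, Real.norm_of_nonneg]
    have := mem_disk.1 ha
    nlinarith [norm_nonneg a]
  rw [le_div_iff₀ (norm_pos_iff.2 hc), norm_mul, hs'] at hg
  refine le_of_eq_of_le ?_ hg
  have : ‖deriv h a‖ ≠ 0 := norm_ne_zero_iff.2 h0
  field_simp

/-- The quotient `growthBound ρ / ρ` decreases in `ρ`, so its value at the largest admissible radius
bounds it below. -/
theorem growthBound_ge {ρ R : ℝ} (hρ : 0 ≤ ρ) (hR : ρ ≤ R) :
    ρ * ((1 + R ^ 2 / 3) / (1 + R) ^ 3) ≤ growthBound ρ := by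
  have hR0 : 0 ≤ R := hρ.trans hR
  rw [growthBound, mul_div_assoc]
  refine mul_le_mul_of_nonneg_left ?_ hρ
  rw [div_le_div_iff₀ (by positivity) (by positivity)]
  have : 0 ≤ (R - ρ) * (9 + 8 * (R + ρ) + 3 * R ^ 2 + 3 * ρ ^ 2 + ρ ^ 2 * R ^ 2) :=
    mul_nonneg (sub_nonneg.2 hR) (by positivity)
  nlinarith

theorem norm_one_add_conj_mul_le {a z : ℂ} {r : ℝ} (ha : ‖a‖ ≤ r) (hz : ‖z‖ ≤ r) :
    ‖1 + conj a * z‖ ≤ 1 + r ^ 2 := by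
  refine (norm_add_le _ _).trans ?_
  rw [norm_one, norm_mul, RCLike.norm_conj, pow_two]
  have := mul_le_mul ha hz (norm_nonneg z) ((norm_nonneg a).trans ha)
  linarith

theorem norm_mobius_le {a z : ℂ} {r : ℝ} (hr : r < 1) (ha : ‖a‖ ≤ r) (hz : ‖z‖ ≤ r) :
    ‖mobius a z‖ ≤ 2 * r / (1 + r ^ 2) := by
  have hr0 : 0 ≤ r := (norm_nonneg a).trans ha
  have ha' : a ∈ disk := mem_disk.2 (ha.trans_lt hr)
  have hz' : z ∈ disk := mem_disk.2 (hz.trans_lt hr)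
  have h0 := norm_pos_iff.2 (one_add_conj_mul_ne_zero ha' hz')
  have key := norm_one_add_conj_mul_sq_sub a z
  have hle := norm_one_add_conj_mul_le ha hz
  have h1 : ‖a‖ ^ 2 ≤ r ^ 2 := by gcongr
  have h2 : ‖z‖ ^ 2 ≤ r ^ 2 := by gcongr
  have h3 : (1 - r ^ 2) * (1 - r ^ 2) ≤ (1 - ‖a‖ ^ 2) * (1 - ‖z‖ ^ 2) := by
    have : 0 ≤ 1 - r ^ 2 := by nlinarith
    exact mul_le_mul (by linarith) (by linarith) this (by linarith)
  have h4 : ‖1 + conj a * z‖ ^ 2 ≤ (1 + r ^ 2) ^ 2 := by gcongr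
  rw [mobius, norm_div, div_le_div_iff₀ h0 (by positivity)]
  refine le_of_sq_le_sq ?_ (by positivity)
  rw [mul_pow, mul_pow]
  nlinarith [mul_nonneg (sub_nonneg.2 h4) (sq_nonneg (1 - r ^ 2)), sq_nonneg (1 + r ^ 2)]

/-- Each factor of `norm_sub_ge_growthBound` is replaced by its worst value on `|a|, |z| ≤ r`; in
particular `2r/(1+r²)` is the largest pseudohyperbolic distance between such points. -/
theorem norm_sub_ge (hF : IsAffineLinearInvariant 𝓕) (ho : upperOrder 𝓕 ≤ 5 / 2)
    (hf : f ∈ 𝓕) (hr : IsCanonicalRep f h g) (hinj : InjOn f disk) (hb : deriv g 0 = 0)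
    {r : ℝ} (hr1 : r < 1) {a z : ℂ} (ha : ‖a‖ ≤ r) (hz : ‖z‖ ≤ r) :
    ((1 - r) / (1 + r)) ^ 3 * ((1 + (2 * r / (1 + r ^ 2)) ^ 2 / 3) /
      (1 + 2 * r / (1 + r ^ 2)) ^ 3) / (1 + r ^ 2) * ‖z - a‖ ≤ ‖f z - f a‖ := by
  have hr0 : 0 ≤ r := (norm_nonneg a).trans ha
  have ha' : a ∈ disk := mem_disk.2 (ha.trans_lt hr1)
  have hz' : z ∈ disk := mem_disk.2 (hz.trans_lt hr1)
  have hna' : ‖-a‖ ≤ r := by rwa [norm_neg]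
  have h1 := norm_sub_ge_growthBound hF ho hf hr hinj ha' hz'
  have h2 := norm_deriv_sub_lower hF ho hf hr ha'
  rw [hb, norm_zero, sub_zero, one_mul] at h2
  have h3 : ‖z - a‖ / (1 + r ^ 2) ≤ ‖mobius (-a) z‖ := by
    have hp := norm_pos_iff.2 (one_add_conj_mul_ne_zero (a := -a)
      (mem_disk.2 (hna'.trans_lt hr1)) hz')
    rw [mobius, norm_div, ← sub_eq_add_neg]
    exact div_le_div_of_nonneg_left (norm_nonneg _) hp (norm_one_add_conj_mul_le hna' hz)
  have h4 := growthBound_ge (norm_nonneg _) (norm_mobius_le hr1 hna' hz)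
  set κ := (1 + (2 * r / (1 + r ^ 2)) ^ 2 / 3) / (1 + 2 * r / (1 + r ^ 2)) ^ 3
  have hκ0 : 0 ≤ κ := by positivity
  have h1a : 0 < 1 - ‖a‖ := by linarith
  have h1r : 0 ≤ 1 - r := by linarith
  have h5 : ((1 - r) / (1 + r)) ^ 3 ≤ (1 - ‖a‖ ^ 2) * (‖deriv h a‖ - ‖deriv g a‖) :=
    calc ((1 - r) / (1 + r)) ^ 3 ≤ ((1 - ‖a‖) / (1 + ‖a‖)) ^ 3 := by gcongr
      _ = (1 - ‖a‖ ^ 2) * ((1 - ‖a‖) ^ 2 / (1 + ‖a‖) ^ 4) := by field_simp; ring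
      _ ≤ _ := mul_le_mul_of_nonneg_left h2 (by nlinarith [norm_nonneg a])
  calc _ = ((1 - r) / (1 + r)) ^ 3 * (‖z - a‖ / (1 + r ^ 2) * κ) := by ring
    _ ≤ ((1 - r) / (1 + r)) ^ 3 * growthBound ‖mobius (-a) z‖ := by
        refine mul_le_mul_of_nonneg_left ?_ (by positivity)
        exact (mul_le_mul_of_nonneg_right h3 hκ0).trans h4
    _ ≤ _ := mul_le_mul_of_nonneg_right h5 (by rw [growthBound]; positivity)
    _ ≤ _ := h1

/-! ### Taylor tails -/

theorem hasSum_coeff {p : ℂ → ℂ} (hp : AnalyticOnNhd ℂ p disk) {z : ℂ} (hz : z ∈ disk) :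
    HasSum (fun k => coeff p k * z ^ k) (p z) := by
  have := Complex.hasSum_taylorSeries_on_ball hp.differentiableOn hz
  refine this.congr_fun ?_
  intro k
  simp only [coeff, smul_eq_mul, sub_zero]
  ring

/-- Estimating the coefficients of `p'` instead of `p` keeps the factor `k + 1`, which later absorbs
the Lipschitz constant `(k+1) r^k` of `z^(k+1)` and leaves a plain geometric series. -/
theorem succ_mul_norm_coeff_le {p : ℂ → ℂ} (hp : AnalyticOnNhd ℂ p disk) {R C : ℝ} (hR0 : 0 < R)
    (hR1 : R < 1) (hC : ∀ z : ℂ, ‖z‖ = R → ‖deriv p z‖ ≤ C) (k : ℕ) :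
    (k + 1) * ‖coeff p (k + 1)‖ ≤ C / R ^ k := by
  have hd : DiffContOnCl ℂ (deriv p) (ball 0 R) := by
    refine (hp.deriv.differentiableOn.mono ?_).diffContOnCl
    rw [closure_ball _ hR0.ne']
    exact closedBall_subset_ball hR1
  have := Complex.norm_iteratedDeriv_le_of_forall_mem_sphere_norm_le k hR0 hd
    fun z hz => hC z (mem_sphere_zero_iff_norm.1 hz)
  have hk : 0 < (k.factorial : ℝ) := by exact_mod_cast k.factorial_pos
  rw [coeff, iteratedDeriv_succ', norm_div, Complex.norm_natCast, Nat.factorial_succ]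
  push_cast
  rw [mul_div_assoc', mul_div_mul_left _ _ (by positivity : (k + 1 : ℝ) ≠ 0), div_le_iff₀ hk]
  calc _ ≤ _ := this
    _ = _ := by ring

theorem norm_pow_succ_sub_le {x y : ℂ} {r : ℝ} (hx : ‖x‖ ≤ r) (hy : ‖y‖ ≤ r) (k : ℕ) :
    ‖x ^ (k + 1) - y ^ (k + 1)‖ ≤ (k + 1) * r ^ k * ‖x - y‖ := by
  have hr : 0 ≤ r := (norm_nonneg x).trans hx
  induction k with
  | zero => simp
  | succ k ih =>
    have e : x ^ (k + 1 + 1) - y ^ (k + 1 + 1) =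
        x ^ (k + 1) * (x - y) + (x ^ (k + 1) - y ^ (k + 1)) * y := by ring
    calc _ ≤ ‖x‖ ^ (k + 1) * ‖x - y‖ + ‖x ^ (k + 1) - y ^ (k + 1)‖ * ‖y‖ := by
          rw [e]
          refine (norm_add_le _ _).trans_eq ?_
          rw [norm_mul, norm_mul, norm_pow]
      _ ≤ r ^ (k + 1) * ‖x - y‖ + (k + 1) * r ^ k * ‖x - y‖ * r := by gcongr
      _ = _ := by push_cast; ring

theorem norm_tail_sub_le {p : ℂ → ℂ} (hp : AnalyticOnNhd ℂ p disk) {r R C : ℝ}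
    (hrR : r < R) (hR1 : R < 1) (hC : ∀ z : ℂ, ‖z‖ = R → ‖deriv p z‖ ≤ C) {x y : ℂ}
    (hx : ‖x‖ ≤ r) (hy : ‖y‖ ≤ r) (n : ℕ) :
    ‖(p x - p y) - (partialSum n p x - partialSum n p y)‖ ≤
      C * ((r / R) ^ n / (1 - r / R)) * ‖x - y‖ := by
  have hr0 : 0 ≤ r := (norm_nonneg x).trans hx
  have hR0 : 0 < R := hr0.trans_lt hrR
  have hC0 : 0 ≤ C := (norm_nonneg _).trans
    (hC (R : ℂ) (by rw [Complex.norm_real, Real.norm_of_nonneg hR0.le]))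
  have hx' : x ∈ disk := mem_disk.2 (by linarith)
  have hy' : y ∈ disk := mem_disk.2 (by linarith)
  have hs := (hasSum_coeff hp hx').sub (hasSum_coeff hp hy')
  have hs' := (hasSum_nat_add_iff' (n + 1)).2 hs
  -- The series starts at index `0` but the section at `1`; the constant terms cancel in the
  -- difference.
  have e : ∑ k ∈ Finset.range (n + 1), (coeff p k * x ^ k - coeff p k * y ^ k) =
      partialSum n p x - partialSum n p y := by
    rw [Finset.sum_range_succ', partialSum, partialSum, ← Finset.sum_sub_distrib]
    simp only [pow_zero, sub_self, add_zero]
    rw [Finset.range_eq_Ico, Finset.sum_Ico_add' (fun k => coeff p k * x ^ k - coeff p k * y ^ k)]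
    rfl
  rw [e] at hs'
  have hq0 : 0 ≤ r / R := div_nonneg hr0 hR0.le
  have hq1 : r / R < 1 := (div_lt_one hR0).2 hrR
  have hgeo := ((hasSum_geometric_of_lt_one hq0 hq1).mul_left (C * (r / R) ^ n * ‖x - y‖))
  refine (hs'.norm_le_of_bounded hgeo fun k => ?_).trans_eq (by ring)
  have h1 := succ_mul_norm_coeff_le hp hR0 hR1 hC (k + n)
  have h2 := norm_pow_succ_sub_le hx hy (k + n)
  push_cast at h1 h2
  rw [← add_assoc k n 1, ← mul_sub, norm_mul]
  calc _ ≤ ‖coeff p (k + n + 1)‖ * (((k : ℝ) + n + 1) * r ^ (k + n) * ‖x - y‖) := by gcongr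
    _ = (((k : ℝ) + n + 1) * ‖coeff p (k + n + 1)‖) * (r ^ (k + n) * ‖x - y‖) := by ring
    _ ≤ C / R ^ (k + n) * (r ^ (k + n) * ‖x - y‖) := by gcongr
    _ = C * (r / R) ^ n * ‖x - y‖ * (r / R) ^ k := by
      rw [div_pow, div_pow, pow_add, pow_add]
      field_simp

/-! ### Univalence of sections -/

theorem injOn_harmonicSection (hF : IsAffineLinearInvariant 𝓕) (ho : upperOrder 𝓕 ≤ 5 / 2)
    (hf : f ∈ 𝓕) (hr : IsCanonicalRep f h g) (hinj : InjOn f disk) (hb : deriv g 0 = 0)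
    {r R : ℝ} (hr0 : 0 < r) (hrR : r < R) (hR1 : R < 1) {N n : ℕ} (hn : N ≤ n)
    (hnum : (1 + R) ^ 2 / (1 - R) ^ 4 * ((r / R) ^ N / (1 - r / R)) <
      ((1 - r) / (1 + r)) ^ 3 * ((1 + (2 * r / (1 + r ^ 2)) ^ 2 / 3) /
        (1 + 2 * r / (1 + r ^ 2)) ^ 3) / (1 + r ^ 2)) :
    InjOn (harmonicSection n n h g) (ball 0 r) := by
  intro x hx y hy e
  by_contra hne
  have hxr := (mem_ball_zero_iff.1 hx).le
  have hyr := (mem_ball_zero_iff.1 hy).le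
  have hdisk : ∀ z : ℂ, ‖z‖ ≤ R → z ∈ disk := fun z hz => mem_disk.2 (hz.trans_lt hR1)
  have hR0 : 0 < R := hr0.trans hrR
  have hq1 : 0 < 1 - r / R := sub_pos.2 ((div_lt_one hR0).2 hrR)
  have hq0 : 0 ≤ r / R := div_nonneg hr0.le hR0.le
  have ht1 := norm_tail_sub_le hr.analytic_left hrR hR1 (C := (1 + R) / (1 - R) ^ 4)
    (fun z hz => by
      simpa [hz] using norm_deriv_left_upper hF ho hf hr hb (hdisk z hz.le)) hxr hyr n
  have ht2 := norm_tail_sub_le hr.analytic_right hrR hR1 (C := R * ((1 + R) / (1 - R) ^ 4))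
    (fun z hz => by
      simpa [hz] using norm_deriv_right_upper hF ho hf hr hb (hdisk z hz.le)) hxr hyr n
  have hlow := norm_sub_ge hF ho hf hr hinj hb (hrR.trans hR1) hyr hxr
  -- Equality of the sections at `x` and `y` leaves only the two tails.
  have hsplit : f x - f y =
      ((h x - h y) - (partialSum n h x - partialSum n h y)) +
        conj ((g x - g y) - (partialSum n g x - partialSum n g y)) := by
    rw [hr.eq_add_conj x (hdisk x (hxr.trans hrR.le)),
      hr.eq_add_conj y (hdisk y (hyr.trans hrR.le))]
    simp only [harmonicSection] at e
    simp only [map_sub]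
    linear_combination e
  have hup : ‖f x - f y‖ ≤
      (1 + R) ^ 2 / (1 - R) ^ 4 * ((r / R) ^ N / (1 - r / R)) * ‖x - y‖ := by
    rw [hsplit]
    refine (norm_add_le _ _).trans ?_
    rw [RCLike.norm_conj]
    calc _ ≤ _ := add_le_add ht1 ht2
      _ = (1 + R) ^ 2 / (1 - R) ^ 4 * ((r / R) ^ n / (1 - r / R)) * ‖x - y‖ := by ring
      _ ≤ _ := by
        have := pow_le_pow_of_le_one hq0 (by linarith) hn
        gcongr
  have hpos : 0 < ‖x - y‖ := norm_pos_iff.2 (sub_ne_zero.2 hne)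
  exact absurd (hlow.trans hup) (not_le.2 (mul_lt_mul_of_pos_right hnum hpos))

end HarmonicMapping

theorem corollary2 (f h g : ℂ → ℂ)
    (hf : f ∈ HarmonicMapping.classUH0 (5 / 2) ∩ HarmonicMapping.classSH0)
    (hrep : HarmonicMapping.IsCanonicalRep f h g) (n : ℕ) :
    (10 ≤ n →
      Set.InjOn (HarmonicMapping.harmonicSection n n h g) (Metric.ball (0 : ℂ) (1 / 4))) ∧
    (29 ≤ n →
      Set.InjOn (HarmonicMapping.harmonicSection n n h g) (Metric.ball (0 : ℂ) (1 / 2))) ∧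
    (98 ≤ n →
      Set.InjOn (HarmonicMapping.harmonicSection n n h g) (Metric.ball (0 : ℂ) (3 / 4))) := by
  obtain ⟨⟨⟨𝓕, ⟨hF, ho⟩, hf𝓕⟩, hb⟩, ⟨-, hinj⟩, -⟩ := hf
  have hb' : deriv g 0 = 0 := by
    rw [hrep.dzbar_eq HarmonicMapping.zero_mem_disk] at hb
    simpa using hb
  refine ⟨fun hn => ?_, fun hn => ?_, fun hn => ?_⟩
  -- In all three cases `R` lies near `N/(N+4)`, where `(1-R)⁻⁴ R⁻ᴺ`, the dominant part of the tail
  -- constant, is least.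
  · exact HarmonicMapping.injOn_harmonicSection hF ho hf𝓕 hrep hinj hb' (R := 7 / 10)
      (by norm_num) (by norm_num) (by norm_num) hn (by norm_num)
  · exact HarmonicMapping.injOn_harmonicSection hF ho hf𝓕 hrep hinj hb' (R := 43 / 50)
      (by norm_num) (by norm_num) (by norm_num) hn (by norm_num)
  · exact HarmonicMapping.injOn_harmonicSection hF ho hf𝓕 hrep hinj hb' (R := 957 / 1000)
      (by norm_num) (by norm_num) (by norm_num) hn (by norm_num)
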